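/- A \emph{gyrogroup} is a set $G$ with a binary operation $\oplus$, a two-sided identity $0$, two-sided inverses $\ominus x$, and, for all $x,y\in G$, an automorphism $\mathrm{gyr}[x,y]$ of $(G,\oplus)$ such that $x\oplus(y\oplus z)=(x\oplus y)\oplus\mathrm{gyr}[x,y](z)$ and $\mathrm{gyr}[x\oplus y,y]=\mathrm{gyr}[x,y]$ for all $x,y,z\in G$. A set $A\subseteq G$ is \emph{gyr-invariant} if $\mathrm{gyr}[x,y](A)=A$ for all $x,y\in G$. A \emph{strongly topological gyrogroup} is a gyrogroup with a topology for which $\oplus$ and $\ominus$ are continuous and every neighborhood of $0$ contains a gyr-invariant neighborhood of $0$ (no separation axiom is assumed). A \emph{subgyrogroup} is a nonempty subset closed under $\oplus$ and $\ominus$; it is \emph{strong} if it is gyr-invariant, and a subgyrogroup $H$ is \emph{neutral} if for every neighborhood $U$ of $0$ there are open neighborhoods $V,V'$ of $0$ with $H\oplus V\subseteq U\oplus H$ and $V'\oplus H\subseteq H\oplus U$. The set $G/H=\{a\oplus H: a\in G\}$ of left cosets carries the quotient topology. For a topological space $X$: (a) $X$ has the \emph{strong Pytkeev property} if for each $x\in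 X$ there is a countable family $\mathcal D$ of subsets of $X$ such that for each neighborhood $U$ of $x$ and each $A\subseteq X$ with $x\in\overline{A}\setminus A$ there is $D\in\mathcal D$ with $D\subseteq U$ and $D\cap A$ infinite. (b) $X$ has \emph{countable $ck$-character} if for each $x\in X$ there is a countable family $\mathcal N$ of subsets of $X$ such that every neighborhood $O$ of $x$ admits a neighborhood $U$ of $x$ such that for each compact $K\subseteq U$ there is a finite $\mathcal F\subseteq\mathcal N$ with $x\in\bigcap\mathcal F$ and $K\subseteq\bigcup\mathcal F\subseteq O$. (c) $X$ has \emph{countable $cn$-character} if for each $x\in X$ there is a countable family $\mathcal N$ of subsets of $X$ such that for every neighborhood $O$ of $x$ the set $\bigcup\{N\in\mathcal N: x\in N\subseteq O\}$ is a neighborhood of $x$. (d) $X$ has an \emph{$\omega^\omega$-base satisfying condition $(\mathbf D)$} if each $x\in X$ has a neighborhood base $\{U_\alpha:\alpha\in\mathbb N^{\mathbb N}\}$ such that $U_\beta\subseteq U_\alpha$ whenever $\alpha\le\beta$ pointwise and such that $U_\alpha=\bigcup_{k\ge1}D_k(\alpha)$ for every $\alpha$, where $D_k(\alpha)=\bigcap\{U_\beta:\beta_i=\alpha_i\text{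 for } i=1,\dots,k\}$. \textbf{Theorem.} Let $H$ be a closed neutral strong subgyrogroup of a strongly topological gyrogroup $G$. If $G/H$ is a Baire space, then the following are equivalent: (1) $G/H$ is metrizable; (2) $G/H$ has the strong Pytkeev property; (3) $G/H$ has countable $ck$-character; (4) $G/H$ has countable $cn$-character; (5) $G/H$ has an $\omega^\omega$-base satisfying condition $(\mathbf D)$. -/

import Mathlib

open Set Topology
open scoped Pointwise

/-- A gyrogroup; the gyro-operation `x ⊕ y` is written `x + y` and the inverse `⊖ x` is `-x`.
Neither commutativity nor associativity is assumed. -/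
class Gyrogroup (G : Type*) extends Zero G, Neg G, Add G where
  zero_add' : ∀ x : G, 0 + x = x
  add_zero' : ∀ x : G, x + 0 = x
  neg_add' : ∀ x : G, -x + x = 0
  add_neg' : ∀ x : G, x + -x = 0
  /-- The gyroautomorphism `gyr[x, y]`, an automorphism of the groupoid `(G, +)`. -/
  gyr : G → G → (G ≃+ G)
  /-- The left gyroassociative law. -/
  add_gyr_assoc : ∀ x y z : G, x + (y + z) = (x + y) + gyr x y z
  /-- The left loop property. -/
  gyr_loop : ∀ x y : G, gyr (x + y) y = gyr x y

/-- A subset `A` of a gyrogroup is gyr-invariant if `gyr[x, y] A = A` for all `x, y`. -/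
def IsGyrInvariant {G : Type*} [Gyrogroup G] (A : Set G) : Prop :=
  ∀ x y : G, Gyrogroup.gyr x y '' A = A

/-- A topological gyrogroup (addition and inversion are continuous) in which every neighborhood
of the identity contains a gyr-invariant neighborhood of the identity. -/
class StronglyTopologicalGyrogroup (G : Type*) [TopologicalSpace G] [Gyrogroup G] : Prop
    extends ContinuousAdd G, ContinuousNeg G where
  exists_gyrInvariant : ∀ U ∈ 𝓝 (0 : G), ∃ V ∈ 𝓝 (0 : G), IsGyrInvariant V ∧ V ⊆ U

/-- A subgyrogroup: a nonempty subset closed under addition and inversion. -/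
structure Subgyrogroup (G : Type*) [Gyrogroup G] where
  carrier : Set G
  nonempty' : carrier.Nonempty
  neg_mem' : ∀ a ∈ carrier, -a ∈ carrier
  add_mem' : ∀ a ∈ carrier, ∀ b ∈ carrier, a + b ∈ carrier

namespace Subgyrogroup

variable {G : Type*} [Gyrogroup G]

/-- A strong subgyrogroup is a gyr-invariant subgyrogroup. -/
def IsStrong (H : Subgyrogroup G) : Prop := IsGyrInvariant H.carrier

/-- For every neighborhood `U` of `0` there is an open neighborhood `V` of `0` with
`H ⊕ V ⊆ U ⊕ H`. -/
def IsInnerNeutral [TopologicalSpace G] (H : Subgyrogroup G) : Prop :=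
  ∀ U ∈ 𝓝 (0 : G), ∃ V : Set G, IsOpen V ∧ (0 : G) ∈ V ∧ H.carrier + V ⊆ U + H.carrier

/-- For every neighborhood `U` of `0` there is an open neighborhood `V` of `0` with
`V ⊕ H ⊆ H ⊕ U`. -/
def IsOuterNeutral [TopologicalSpace G] (H : Subgyrogroup G) : Prop :=
  ∀ U ∈ 𝓝 (0 : G), ∃ V : Set G, IsOpen V ∧ (0 : G) ∈ V ∧ V + H.carrier ⊆ H.carrier + U

/-- A subgyrogroup is neutral if it is both inner neutral and outer neutral. -/
def IsNeutral [TopologicalSpace G] (H : Subgyrogroup G) : Prop :=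
  H.IsInnerNeutral ∧ H.IsOuterNeutral

/-- The left coset `a ⊕ H`. -/
def leftCoset (H : Subgyrogroup G) (a : G) : Set G := (fun h => a + h) '' H.carrier

/-- Two elements are related when they have the same left coset `a ⊕ H`. -/
def leftRel (H : Subgyrogroup G) : Setoid G := Setoid.ker H.leftCoset

/-- `G ⧸ H` is the set of left cosets `a ⊕ H`. -/
instance : HasQuotient G (Subgyrogroup G) := ⟨fun H => Quotient H.leftRel⟩

/-- `G ⧸ H` carries the quotient topology: `O` is open iff its preimage in `G` is open. -/
instance [TopologicalSpace G] (H : Subgyrogroup G) : TopologicalSpace (G ⧸ H) :=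
  inferInstanceAs (TopologicalSpace (Quotient H.leftRel))

end Subgyrogroup

/-- The strong Pytkeev property. -/
def HasStrongPytkeevProperty (X : Type*) [TopologicalSpace X] : Prop :=
  ∀ x : X, ∃ 𝒟 : Set (Set X), 𝒟.Countable ∧
    ∀ U ∈ 𝓝 x, ∀ A : Set X, x ∈ closure A \ A → ∃ D ∈ 𝒟, D ⊆ U ∧ (D ∩ A).Infinite

/-- `𝒩` is a `ck`-network at `x`: every neighborhood `O` of `x` contains the members of finite
subfamilies of `𝒩`, all of whose members contain `x`, covering the compact subsets of some
neighborhood `U` of `x`. -/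
def IsCkNetworkAt {X : Type*} [TopologicalSpace X] (𝒩 : Set (Set X)) (x : X) : Prop :=
  ∀ O ∈ 𝓝 x, ∃ U ∈ 𝓝 x, ∀ K : Set X, IsCompact K → K ⊆ U →
    ∃ ℱ : Set (Set X), ℱ.Finite ∧ ℱ ⊆ 𝒩 ∧ x ∈ ⋂₀ ℱ ∧ K ⊆ ⋃₀ ℱ ∧ ⋃₀ ℱ ⊆ O

/-- `𝒩` is a `cn`-network at `x`: for every neighborhood `O` of `x` the union of all `N ∈ 𝒩` with
`x ∈ N ⊆ O` is a neighborhood of `x`. -/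
def IsCnNetworkAt {X : Type*} [TopologicalSpace X] (𝒩 : Set (Set X)) (x : X) : Prop :=
  ∀ O ∈ 𝓝 x, ⋃₀ {N : Set X | N ∈ 𝒩 ∧ x ∈ N ∧ N ⊆ O} ∈ 𝓝 x

/-- Every point has a countable `ck`-network. -/
def HasCountableCkCharacter (X : Type*) [TopologicalSpace X] : Prop :=
  ∀ x : X, ∃ 𝒩 : Set (Set X), 𝒩.Countable ∧ IsCkNetworkAt 𝒩 x

/-- Every point has a countable `cn`-network. -/
def HasCountableCnCharacter (X : Type*) [TopologicalSpace X] : Prop :=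
  ∀ x : X, ∃ 𝒩 : Set (Set X), 𝒩.Countable ∧ IsCnNetworkAt 𝒩 x

/-- The set of all sequences that agree with `α` in its first `k` terms. -/
def initialSegmentSet (k : ℕ) (α : ℕ → ℕ) : Set (ℕ → ℕ) := {β | ∀ i < k, β i = α i}

/-- `D_k(α) = ⋂ {U_β : β ∈ I_k(α)}`. -/
def segmentInter {X : Type*} (U : (ℕ → ℕ) → Set X) (k : ℕ) (α : ℕ → ℕ) : Set X :=
  ⋂ β ∈ initialSegmentSet k α, U β

/-- Condition `(D)`: `U_α = ⋃ {D_k(α) : k ≥ 1}` for every `α`. -/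
def SatisfiesConditionD {X : Type*} (U : (ℕ → ℕ) → Set X) : Prop :=
  ∀ α : ℕ → ℕ, U α = ⋃ k ∈ Ici 1, segmentInter U k α

/-- Every point has a neighborhood base `(U_α)` indexed by `ℕ → ℕ` with the pointwise order,
with `U_β ⊆ U_α` whenever `α ≤ β`, satisfying condition `(D)`. -/
def HasOmegaOmegaBaseWithConditionD (X : Type*) [TopologicalSpace X] : Prop :=
  ∀ x : X, ∃ U : (ℕ → ℕ) → Set X,
    (𝓝 x).HasBasis (fun _ => True) U ∧ Antitone U ∧ SatisfiesConditionD U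

/-!
Metrizability yields the other properties through a countable decreasing base at each point.
Conversely the strong Pytkeev property, countable `ck`-character, and an `ω^ω`-base satisfying
condition `(D)` each yield a countable `cn`-network at every point, so the theorem comes down to
deducing metrizability from a countable `cn`-network `𝒩` at the coset `0 ⊕ H` when `G ⧸ H` is Baire.

Since `H` is gyr-invariant, the identity `⊖(x ⊕ b) ⊕ (x ⊕ c) = gyr[x, b] (⊖b ⊕ c)` shows that the
relation `⊖x ⊕ y ∈ S` depends only on the cosets of `x` and `y`, as long as `S` is gyr-invariant,
symmetric, and stable under adding elements of `H` on either side. Neutrality of `H` makes the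
neighborhoods `S` of this kind (`IsBiinvariantNhd`) plentiful: every neighborhood of `0` that is a
union of left cosets contains one (`exists_isBiinvariantNhd_subset`). Hence they generate a
uniformity on `G ⧸ H` inducing the quotient topology (`quotientUniformSpace`), and as `H` is closed,
`G ⧸ H` is metrizable as soon as this uniformity is countably generated.

Finally, let `C` be a closed neighborhood of `0 ⊕ H`. The countably many members of `𝒩` inside `C`
cover a neighborhood of `0 ⊕ H`, which is nonmeager; so some `N ∈ 𝒩` with `N ⊆ C` has a closure with
nonempty interior `I`, contained in `C`. The differences `⊖a ⊕ b` of elements over `I` form a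
neighborhood of `0` in `G`, which is small when `C` is. Countably many neighborhoods obtained in
this way, one for each `N`, generate the uniformity (`exists_countable_isBiinvariantNhd`).
-/

/-! ### Gyrogroup identities -/

namespace Gyrogroup

variable {G : Type*} [Gyrogroup G]

lemma add_left_cancel' {a b c : G} (h : a + b = a + c) : b = c := by
  have h' : -a + (a + b) = -a + (a + c) := by rw [h]
  rw [add_gyr_assoc, add_gyr_assoc, neg_add', zero_add', zero_add'] at h'
  exact (gyr (-a) a).injective h'

lemma gyr_zero_left (a z : G) : gyr 0 a z = z := by
  have h := add_gyr_assoc 0 a z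
  rw [zero_add', zero_add'] at h
  exact (add_left_cancel' h).symm

lemma neg_add_cancel_left' (a b : G) : -a + (a + b) = b := by
  have h := gyr_loop (-a) a
  rw [neg_add'] at h
  rw [add_gyr_assoc, neg_add', zero_add', ← h, gyr_zero_left]

lemma neg_neg' (a : G) : - -a = a :=
  add_left_cancel' (a := -a) (by rw [add_neg', neg_add'])

lemma add_neg_cancel_left' (a b : G) : a + (-a + b) = b := by
  have h := neg_add_cancel_left' (-a) b
  rwa [neg_neg'] at h

lemma add_assoc_gyr_symm (a b c : G) : (a + b) + c = a + (b + (gyr a b).symm c) := by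
  rw [add_gyr_assoc, AddEquiv.apply_symm_apply]

lemma neg_add_eq_gyr (a b : G) : -(a + b) = gyr a b (-b + -a) := by
  apply add_left_cancel' (a := a + b)
  rw [← add_gyr_assoc, add_neg_cancel_left', add_neg', add_neg']

lemma neg_add_add_eq_gyr (a b c : G) : -(a + b) + (a + c) = gyr a b (-b + c) := by
  apply add_left_cancel' (a := a + b)
  rw [← add_gyr_assoc, add_neg_cancel_left', add_neg_cancel_left']

lemma gyr_neg (a b z : G) : gyr a b (-z) = -gyr a b z := by
  have h0 : gyr a b 0 = 0 := by
    apply add_left_cancel' (a := gyr a b 0)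
    rw [← map_add, add_zero', add_zero']
  apply add_left_cancel' (a := gyr a b z)
  rw [← map_add, add_neg', add_neg', h0]

end Gyrogroup

open Gyrogroup

/-! ### Gyr-invariant sets -/

namespace IsGyrInvariant

variable {G : Type*} [Gyrogroup G] {A B C : Set G}

lemma gyr_mem (hA : IsGyrInvariant A) (x y : G) {z : G} (hz : z ∈ A) : gyr x y z ∈ A :=
  hA x y ▸ mem_image_of_mem _ hz

lemma gyr_symm_mem (hA : IsGyrInvariant A) (x y : G) {z : G} (hz : z ∈ A) :
    (gyr x y).symm z ∈ A := by
  rw [← hA x y] at hz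
  obtain ⟨w, hw, rfl⟩ := hz
  rwa [AddEquiv.symm_apply_apply]

protected lemma add (hA : IsGyrInvariant A) (hB : IsGyrInvariant B) : IsGyrInvariant (A + B) := by
  intro x y
  have h : gyr x y '' (A + B) = gyr x y '' A + gyr x y '' B :=
    image_image2_distrib (map_add (gyr x y))
  rw [h, hA, hB]

protected lemma inter (hA : IsGyrInvariant A) (hB : IsGyrInvariant B) :
    IsGyrInvariant (A ∩ B) := by
  intro x y
  rw [image_inter (gyr x y).injective, hA, hB]

lemma preimage_neg (hA : IsGyrInvariant A) : IsGyrInvariant {x | -x ∈ A} := by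
  intro x y
  ext z
  constructor
  · rintro ⟨w, hw, rfl⟩
    rw [mem_ofPred_eq, ← gyr_neg]
    exact hA.gyr_mem x y hw
  · intro hz
    refine ⟨(gyr x y).symm z, ?_, by simp⟩
    obtain ⟨w, hw, hwz⟩ := (hA x y).symm ▸ (show -z ∈ A from hz)
    have : z = gyr x y (-w) := by rw [gyr_neg, hwz, neg_neg']
    rw [this, AddEquiv.symm_apply_apply, mem_ofPred_eq, neg_neg']
    exact hw

/-- Addition of subsets is associative when the last one is gyr-invariant. -/
protected lemma add_assoc (A B : Set G) (hC : IsGyrInvariant C) : A + B + C = A + (B + C) := by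
  apply Subset.antisymm
  · rintro _ ⟨_, ⟨a, ha, b, hb, rfl⟩, c, hc, rfl⟩
    exact ⟨a, ha, _, ⟨b, hb, _, hC.gyr_symm_mem a b hc, rfl⟩, (add_assoc_gyr_symm a b c).symm⟩
  · rintro _ ⟨a, ha, _, ⟨b, hb, c, hc, rfl⟩, rfl⟩
    exact ⟨_, ⟨a, ha, b, hb, rfl⟩, _, hC.gyr_mem a b hc, (add_gyr_assoc a b c).symm⟩

end IsGyrInvariant

/-! ### Cosets of a strong subgyrogroup -/

namespace Subgyrogroup

variable {G : Type*} [Gyrogroup G] (H : Subgyrogroup G)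

lemma zero_mem : (0 : G) ∈ H.carrier := by
  obtain ⟨h, hh⟩ := H.nonempty'
  exact neg_add' h ▸ H.add_mem' _ (H.neg_mem' h hh) _ hh

/-- The projection of `G` onto `G ⧸ H`. -/
def proj (a : G) : G ⧸ H := Quotient.mk H.leftRel a

lemma proj_surjective : Function.Surjective H.proj := Quotient.mk_surjective

lemma isQuotientMap_proj [TopologicalSpace G] : IsQuotientMap H.proj := isQuotientMap_quot_mk

variable {H}

lemma IsStrong.proj_eq_proj_iff (hs : H.IsStrong) {a b : G} :
    H.proj a = H.proj b ↔ -a + b ∈ H.carrier := by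
  have hproj : H.proj a = H.proj b ↔ H.leftCoset a = H.leftCoset b := Quotient.eq (r := H.leftRel)
  rw [hproj]
  constructor
  · intro h
    have hb : b ∈ H.leftCoset a := h ▸ ⟨0, H.zero_mem, add_zero' b⟩
    obtain ⟨k, hk, rfl⟩ := hb
    rwa [neg_add_cancel_left']
  · intro h
    obtain ⟨k, rfl⟩ : ∃ k, b = a + k := ⟨-a + b, (add_neg_cancel_left' a b).symm⟩
    rw [neg_add_cancel_left'] at h
    apply Subset.antisymm
    · rintro _ ⟨m, hm, rfl⟩
      refine ⟨-(a + k) + (a + m), ?_, add_neg_cancel_left' _ _⟩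
      rw [neg_add_add_eq_gyr]
      exact IsGyrInvariant.gyr_mem hs _ _ (H.add_mem' _ (H.neg_mem' k h) _ hm)
    · rintro _ ⟨m, hm, rfl⟩
      exact ⟨_, H.add_mem' _ h _ (IsGyrInvariant.gyr_symm_mem hs a k hm),
        (add_assoc_gyr_symm a k m).symm⟩

lemma IsStrong.proj_add (hs : H.IsStrong) (a : G) {h : G} (hh : h ∈ H.carrier) :
    H.proj (a + h) = H.proj a :=
  (hs.proj_eq_proj_iff.2 (by rwa [neg_add_cancel_left'])).symm

variable (H) in
lemma carrier_add_carrier : H.carrier + H.carrier = H.carrier := by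
  apply Subset.antisymm
  · rintro _ ⟨a, ha, b, hb, rfl⟩
    exact H.add_mem' a ha b hb
  · intro a ha
    exact ⟨a, ha, 0, H.zero_mem, add_zero' a⟩

variable (H) in
/-- The relation on `G ⧸ H` induced by `-x + y ∈ S`. -/
def entourage (S : Set G) : Set ((G ⧸ H) × (G ⧸ H)) :=
  Prod.map H.proj H.proj '' {p | -p.1 + p.2 ∈ S}

lemma entourage_mono {S T : Set G} (h : S ⊆ T) : H.entourage S ⊆ H.entourage T :=
  image_mono fun _ hp => h hp

/-! ### Bi-invariant neighborhoods of the identity -/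

/-- A neighborhood of `0` that is gyr-invariant, symmetric, and stable under the addition of
elements of `H` on either side. For such `S` the relation `-x + y ∈ S` descends to `G ⧸ H`. -/
structure IsBiinvariantNhd [TopologicalSpace G] (H : Subgyrogroup G) (S : Set G) : Prop where
  mem_nhds : S ∈ 𝓝 (0 : G)
  gyr : IsGyrInvariant S
  neg : ∀ s ∈ S, -s ∈ S
  add_left : ∀ h ∈ H.carrier, ∀ s ∈ S, h + s ∈ S
  add_right : ∀ s ∈ S, ∀ h ∈ H.carrier, s + h ∈ S

variable [TopologicalSpace G]

namespace IsBiinvariantNhd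

variable {S T : Set G}

lemma zero_mem (hS : H.IsBiinvariantNhd S) : (0 : G) ∈ S := mem_of_mem_nhds hS.mem_nhds

variable (H) in
lemma univ : H.IsBiinvariantNhd (Set.univ : Set G) where
  mem_nhds := Filter.univ_mem
  gyr x y := image_univ_of_surjective (Gyrogroup.gyr x y).surjective
  neg _ _ := mem_univ _
  add_left _ _ _ _ := mem_univ _
  add_right _ _ _ _ := mem_univ _

lemma inter (hS : H.IsBiinvariantNhd S) (hT : H.IsBiinvariantNhd T) :
    H.IsBiinvariantNhd (S ∩ T) where
  mem_nhds := Filter.inter_mem hS.mem_nhds hT.mem_nhds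
  gyr := hS.gyr.inter hT.gyr
  neg s hs := ⟨hS.neg s hs.1, hT.neg s hs.2⟩
  add_left h hh s hs := ⟨hS.add_left h hh s hs.1, hT.add_left h hh s hs.2⟩
  add_right s hs h hh := ⟨hS.add_right s hs.1 h hh, hT.add_right s hs.2 h hh⟩

/-- Membership of `-x + y` in `S` depends only on the cosets of `x` and `y`. -/
lemma neg_add_mem_of_proj_eq (hs : H.IsStrong) (hS : H.IsBiinvariantNhd S) {x y x' y' : G}
    (hx : H.proj x = H.proj x') (hy : H.proj y = H.proj y') (h : -x + y ∈ S) : -x' + y' ∈ S := by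
  have hx := hs.proj_eq_proj_iff.1 hx
  have hy := hs.proj_eq_proj_iff.1 hy
  obtain ⟨k, rfl⟩ : ∃ k, x' = x + k := ⟨-x + x', (add_neg_cancel_left' _ _).symm⟩
  obtain ⟨m, rfl⟩ : ∃ m, y' = y + m := ⟨-y + y', (add_neg_cancel_left' _ _).symm⟩
  obtain ⟨c, rfl⟩ : ∃ c, y = x + c := ⟨-x + y, (add_neg_cancel_left' _ _).symm⟩
  rw [neg_add_cancel_left'] at hx hy h
  rw [add_assoc_gyr_symm x c m, neg_add_add_eq_gyr]
  exact hS.gyr.gyr_mem _ _ (hS.add_left _ (H.neg_mem' k hx) _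
    (hS.add_right _ h _ (IsGyrInvariant.gyr_symm_mem hs x c hy)))

lemma neg_add_mem_symm (hS : H.IsBiinvariantNhd S) {x y : G} (h : -x + y ∈ S) : -y + x ∈ S := by
  obtain ⟨c, rfl⟩ : ∃ c, y = x + c := ⟨-x + y, (add_neg_cancel_left' _ _).symm⟩
  rw [neg_add_cancel_left'] at h
  have h' := neg_add_add_eq_gyr x c 0
  rw [add_zero', add_zero'] at h'
  rw [h']
  exact hS.gyr.gyr_mem _ _ (hS.neg c h)

lemma neg_add_mem_trans (hT : H.IsBiinvariantNhd T) (hTS : T + T ⊆ S) {x y z : G}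
    (h₁ : -x + y ∈ T) (h₂ : -y + z ∈ T) : -x + z ∈ S := by
  obtain ⟨s, rfl⟩ : ∃ s, y = x + s := ⟨-x + y, (add_neg_cancel_left' _ _).symm⟩
  obtain ⟨t, rfl⟩ : ∃ t, z = x + s + t := ⟨-(x + s) + z, (add_neg_cancel_left' _ _).symm⟩
  rw [neg_add_cancel_left'] at h₁ h₂
  rw [add_assoc_gyr_symm, neg_add_cancel_left']
  exact hTS ⟨s, h₁, _, hT.gyr.gyr_symm_mem _ _ h₂, rfl⟩

end IsBiinvariantNhd

lemma IsBiinvariantNhd.proj_mem_entourage (hs : H.IsStrong) {S : Set G}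
    (hS : H.IsBiinvariantNhd S) {x y : G} :
    (H.proj x, H.proj y) ∈ H.entourage S ↔ -x + y ∈ S := by
  constructor
  · rintro ⟨⟨x', y'⟩, h, hxy⟩
    rw [Prod.map_apply, Prod.mk.injEq] at hxy
    exact hS.neg_add_mem_of_proj_eq hs hxy.1 hxy.2 h
  · exact fun h => ⟨(x, y), h, rfl⟩

variable [StronglyTopologicalGyrogroup G]

/-- For inner neutral `H`, every neighborhood `O` of `0` admits a bi-invariant neighborhood inside
`O ⊕ H`, namely `H ⊕ (U ⊕ H)` for a small gyr-invariant symmetric `U`. -/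
lemma IsInnerNeutral.exists_isBiinvariantNhd_subset_add (hs : H.IsStrong)
    (hn : H.IsInnerNeutral) {O : Set G} (hO : O ∈ 𝓝 (0 : G)) :
    ∃ S, H.IsBiinvariantNhd S ∧ S ⊆ O + H.carrier := by
  have hs' : IsGyrInvariant H.carrier := hs
  obtain ⟨V, hVo, h0V, hV⟩ := hn O hO
  obtain ⟨W, hW, hWg, hWV⟩ :=
    StronglyTopologicalGyrogroup.exists_gyrInvariant V (hVo.mem_nhds h0V)
  set U := W ∩ {x | -x ∈ W}
  have hUg : IsGyrInvariant U := hWg.inter hWg.preimage_neg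
  have neg_zero_eq : -(0 : G) = 0 := by rw [← zero_add' (-(0 : G)), Gyrogroup.add_neg']
  have hU0 : U ∈ 𝓝 (0 : G) := by
    refine Filter.inter_mem hW ((continuous_neg (G := G)).continuousAt.preimage_mem_nhds ?_)
    rwa [neg_zero_eq]
  have hUneg : ∀ u ∈ U, -u ∈ U := fun u hu => ⟨hu.2, by
    rw [mem_ofPred_eq, neg_neg']
    exact hu.1⟩
  have assoc : H.carrier + (U + H.carrier) = H.carrier + U + H.carrier :=
    (IsGyrInvariant.add_assoc _ _ hs').symm
  have hg : IsGyrInvariant (H.carrier + (U + H.carrier)) := hs'.add (hUg.add hs')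
  have hHH := H.carrier_add_carrier
  refine ⟨H.carrier + (U + H.carrier), ⟨?_, hg, ?_, ?_, ?_⟩, ?_⟩
  · refine Filter.mem_of_superset hU0 fun u hu => ?_
    exact ⟨0, H.zero_mem, u, ⟨u, hu, 0, H.zero_mem, add_zero' u⟩, zero_add' u⟩
  · rintro _ ⟨h, hh, _, ⟨u, hu, k, hk, rfl⟩, rfl⟩
    rw [neg_add_eq_gyr]
    refine hg.gyr_mem _ _ ?_
    rw [assoc, neg_add_eq_gyr]
    exact ⟨_, (hs'.add hUg).gyr_mem _ _ ⟨_, H.neg_mem' k hk, _, hUneg u hu, rfl⟩, _,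
      H.neg_mem' h hh, rfl⟩
  · intro h hh s hs
    have := add_mem_add hh hs
    rwa [← IsGyrInvariant.add_assoc _ _ (hUg.add hs'), hHH] at this
  · intro s hs h hh
    have := add_mem_add hs hh
    rwa [assoc, IsGyrInvariant.add_assoc _ _ hs', hHH, ← assoc] at this
  · calc H.carrier + (U + H.carrier) = H.carrier + U + H.carrier := assoc
      _ ⊆ O + H.carrier + H.carrier :=
        add_subset_add_right ((add_subset_add_left (inter_subset_left.trans hWV)).trans hV)
      _ = O + H.carrier := by rw [IsGyrInvariant.add_assoc _ _ hs', hHH]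

lemma IsInnerNeutral.exists_isBiinvariantNhd_subset (hs : H.IsStrong) (hn : H.IsInnerNeutral)
    {W : Set G} (hW : W ∈ 𝓝 (0 : G)) (hWH : ∀ w ∈ W, ∀ h ∈ H.carrier, w + h ∈ W) :
    ∃ S, H.IsBiinvariantNhd S ∧ S ⊆ W := by
  obtain ⟨S, hS, hSW⟩ := hn.exists_isBiinvariantNhd_subset_add hs hW
  refine ⟨S, hS, hSW.trans ?_⟩
  rintro _ ⟨w, hw, h, hh, rfl⟩
  exact hWH w hw h hh

lemma IsInnerNeutral.exists_isBiinvariantNhd_add_subset (hs : H.IsStrong)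
    (hn : H.IsInnerNeutral) {S : Set G} (hS : H.IsBiinvariantNhd S) :
    ∃ T, H.IsBiinvariantNhd T ∧ T + T ⊆ S := by
  have hS0 : S ∈ 𝓝 ((0 : G) + 0) := by
    rw [add_zero']
    exact hS.mem_nhds
  have hadd := (continuous_add (M := G)).continuousAt (x := ((0 : G), (0 : G))) hS0
  rw [Filter.mem_map, nhds_prod_eq, Filter.mem_prod_same_iff] at hadd
  obtain ⟨O, hO, hOS⟩ := hadd
  obtain ⟨T, hT, hTO⟩ := hn.exists_isBiinvariantNhd_subset_add hs hO
  refine ⟨T, hT, ?_⟩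
  have hHT : H.carrier + T ⊆ T := by
    rintro _ ⟨h, hh, t, ht, rfl⟩
    exact hT.add_left h hh t ht
  calc T + T ⊆ O + H.carrier + T := add_subset_add_right hTO
    _ = O + (H.carrier + T) := IsGyrInvariant.add_assoc _ _ hT.gyr
    _ ⊆ O + (O + H.carrier) := add_subset_add_left (hHT.trans hTO)
    _ = O + O + H.carrier := (IsGyrInvariant.add_assoc _ _ hs).symm
    _ ⊆ S := by
      rintro _ ⟨_, ⟨a, ha, b, hb, rfl⟩, h, hh, rfl⟩
      exact hS.add_right _ (hOS (mk_mem_prod ha hb)) h hh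

/-! ### The uniformity of the coset space -/

variable (H) in
/-- The entourages of bi-invariant neighborhoods form a filter basis. -/
def entourageBasis : FilterBasis ((G ⧸ H) × (G ⧸ H)) where
  sets := H.entourage '' {S | H.IsBiinvariantNhd S}
  nonempty := ⟨_, _, IsBiinvariantNhd.univ H, rfl⟩
  inter_sets := by
    rintro _ _ ⟨S, hS, rfl⟩ ⟨T, hT, rfl⟩
    exact ⟨_, ⟨_, hS.inter hT, rfl⟩,
      subset_inter (entourage_mono inter_subset_left) (entourage_mono inter_subset_right)⟩

/-- The uniformity on `G ⧸ H` with basis the entourages of bi-invariant neighborhoods. -/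
def quotientUniformCore (hs : H.IsStrong) (hn : H.IsInnerNeutral) :
    UniformSpace.Core (G ⧸ H) :=
  UniformSpace.Core.mkOfBasis H.entourageBasis
    (by
      rintro _ ⟨S, hS, rfl⟩ p
      obtain ⟨x, rfl⟩ := H.proj_surjective p
      rw [IsBiinvariantNhd.proj_mem_entourage hs hS, Gyrogroup.neg_add']
      exact hS.zero_mem)
    (by
      rintro _ ⟨S, hS, rfl⟩
      refine ⟨_, ⟨S, hS, rfl⟩, ?_⟩
      rintro _ ⟨⟨x, y⟩, h, rfl⟩
      exact ⟨(y, x), hS.neg_add_mem_symm h, rfl⟩)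
    (by
      rintro _ ⟨S, hS, rfl⟩
      obtain ⟨T, hT, hTS⟩ := hn.exists_isBiinvariantNhd_add_subset hs hS
      refine ⟨_, ⟨T, hT, rfl⟩, ?_⟩
      rintro ⟨p, r⟩ ⟨q, hpq, hqr⟩
      obtain ⟨x, rfl⟩ := H.proj_surjective p
      obtain ⟨y, rfl⟩ := H.proj_surjective q
      obtain ⟨z, rfl⟩ := H.proj_surjective r
      rw [IsBiinvariantNhd.proj_mem_entourage hs hT] at hpq hqr
      exact ⟨(x, z), hT.neg_add_mem_trans hTS hpq hqr, rfl⟩)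

lemma quotientUniformCore_hasBasis (hs : H.IsStrong) (hn : H.IsInnerNeutral) :
    (quotientUniformCore hs hn).uniformity.HasBasis H.IsBiinvariantNhd H.entourage :=
  ⟨fun t => by
    refine (H.entourageBasis.mem_filter_iff (U := t)).trans ?_
    constructor
    · rintro ⟨_, ⟨S, hS, rfl⟩, h⟩
      exact ⟨S, hS, h⟩
    · rintro ⟨S, hS, h⟩
      exact ⟨_, ⟨S, hS, rfl⟩, h⟩⟩

/-- Openness in the quotient topology is tested by translates of bi-invariant neighborhoods: the
preimage in `G` of an open set, translated to `0`, is a union of left cosets. -/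
lemma isOpen_quotient_iff (hs : H.IsStrong) (hn : H.IsInnerNeutral) {s : Set (G ⧸ H)} :
    IsOpen s ↔ ∀ x, H.proj x ∈ s → ∃ S, H.IsBiinvariantNhd S ∧ ∀ g ∈ S, H.proj (x + g) ∈ s := by
  rw [← H.isQuotientMap_proj.isOpen_preimage]
  constructor
  · intro ho x hx
    have hcont : Continuous fun g : G => x + g := continuous_const.add continuous_id
    refine hn.exists_isBiinvariantNhd_subset hs (W := {g | H.proj (x + g) ∈ s})
      ((ho.preimage hcont).mem_nhds ?_) fun w hw h hh => ?_
    · rwa [mem_preimage, add_zero']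
    · rw [mem_ofPred_eq, add_gyr_assoc, hs.proj_add _ (IsGyrInvariant.gyr_mem hs _ _ hh)]
      exact hw
  · intro h
    rw [isOpen_iff_mem_nhds]
    intro x hx
    obtain ⟨S, hS, hSs⟩ := h x hx
    have hcont : Continuous fun g : G => -x + g := continuous_const.add continuous_id
    have hx' : S ∈ 𝓝 (-x + x) := by
      rw [Gyrogroup.neg_add']
      exact hS.mem_nhds
    filter_upwards [hcont.continuousAt.preimage_mem_nhds hx'] with y hy
    have := hSs _ hy
    rwa [add_neg_cancel_left'] at this

/-- The uniform structure on `G ⧸ H` inducing the quotient topology. -/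
abbrev quotientUniformSpace (hs : H.IsStrong) (hn : H.IsInnerNeutral) :
    UniformSpace (G ⧸ H) :=
  UniformSpace.ofCoreEq (quotientUniformCore hs hn) inferInstance <| by
    refine TopologicalSpace.ext_iff.2 fun s => ?_
    rw [isOpen_quotient_iff hs hn, @isOpen_iff_mem_nhds _ (_) s,
      H.proj_surjective.forall]
    refine forall₂_congr fun x hx => ?_
    rw [UniformSpace.Core.nhds_toTopologicalSpace,
      ((quotientUniformCore_hasBasis hs hn).comap _).mem_iff]
    refine exists_congr fun S => and_congr_right fun hS => ?_
    constructor
    · intro h p hp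
      obtain ⟨y, rfl⟩ := H.proj_surjective p
      have := h _ ((IsBiinvariantNhd.proj_mem_entourage hs hS).1 hp)
      rwa [add_neg_cancel_left'] at this
    · intro h g hg
      refine h ((IsBiinvariantNhd.proj_mem_entourage hs hS).2 ?_)
      rwa [neg_add_cancel_left']

lemma t1Space_quotient (hs : H.IsStrong) (hc : IsClosed H.carrier) : T1Space (G ⧸ H) := by
  refine ⟨fun p => ?_⟩
  obtain ⟨x, rfl⟩ := H.proj_surjective p
  rw [← H.isQuotientMap_proj.isClosed_preimage]
  have hcont : Continuous fun g : G => -x + g := continuous_const.add continuous_id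
  convert! hc.preimage hcont using 1
  ext y
  rw [mem_preimage, mem_singleton_iff, eq_comm, hs.proj_eq_proj_iff, mem_preimage]

end Subgyrogroup

/-! ### Metrizability from a countable `cn`-network -/

/-- In a regular Baire space with a countable `cn`-network at `x`, every neighborhood of `x`
contains the closure of a member of the network which is not nowhere dense. -/
lemma IsCnNetworkAt.exists_closure_subset {X : Type*} [TopologicalSpace X] [RegularSpace X]
    [BaireSpace X] {𝒩 : Set (Set X)} {x : X} (h𝒩 : IsCnNetworkAt 𝒩 x) (hc : 𝒩.Countable)
    {O : Set X} (hO : O ∈ 𝓝 x) :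
    ∃ N ∈ 𝒩, (interior (closure N)).Nonempty ∧ closure N ⊆ O := by
  obtain ⟨C, hC, hCc, hCO⟩ := exists_mem_nhds_isClosed_subset hO
  by_contra! hcon
  have hW := h𝒩 C hC
  refine not_isMeagre_of_isOpen isOpen_interior ⟨x, mem_interior_iff_mem_nhds.2 hW⟩
    (IsMeagre.mono interior_subset ?_)
  rw [isMeagre_iff_countable_union_isNowhereDense]
  refine ⟨_, fun N hN => ?_, hc.mono fun N hN => hN.1, subset_rfl⟩
  by_contra hne
  exact hcon N hN.1 (nonempty_iff_ne_empty.2 hne) ((closure_minimal hN.2.2 hCc).trans hCO)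

namespace Subgyrogroup

variable {G : Type*} [Gyrogroup G] {H : Subgyrogroup G} [TopologicalSpace G]
  [StronglyTopologicalGyrogroup G]

/-- The differences `-a + b` of elements lying over a nonempty open set `I` of cosets contain a
bi-invariant neighborhood. -/
lemma exists_isBiinvariantNhd_subset_differences (hs : H.IsStrong) (hn : H.IsInnerNeutral)
    {I : Set (G ⧸ H)} (hI : IsOpen I) (hne : I.Nonempty) :
    ∃ S, H.IsBiinvariantNhd S ∧ ∀ g ∈ S, ∃ a b, H.proj a ∈ I ∧ H.proj b ∈ I ∧ g = -a + b := by
  obtain ⟨p, hp⟩ := hne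
  obtain ⟨a, rfl⟩ := H.proj_surjective p
  obtain ⟨S, hS, hSI⟩ := (isOpen_quotient_iff hs hn).1 hI a hp
  exact ⟨S, hS, fun g hg => ⟨a, a + g, hp, hSI g hg, (neg_add_cancel_left' a g).symm⟩⟩

/-- A countable `cn`-network at the identity coset of a Baire coset space yields countably many
bi-invariant neighborhoods that are cofinal among all of them. -/
lemma exists_countable_isBiinvariantNhd [BaireSpace (G ⧸ H)] (hs : H.IsStrong)
    (hn : H.IsInnerNeutral) {𝒩 : Set (Set (G ⧸ H))} (hc : 𝒩.Countable)
    (h𝒩 : IsCnNetworkAt 𝒩 (H.proj 0)) :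
    ∃ 𝒞 : Set (Set G), 𝒞.Countable ∧ (∀ S ∈ 𝒞, H.IsBiinvariantNhd S) ∧
      ∀ S, H.IsBiinvariantNhd S → ∃ T ∈ 𝒞, T ⊆ S := by
  let _ := quotientUniformSpace hs hn
  set 𝒩' := {N | N ∈ 𝒩 ∧ (interior (closure N)).Nonempty}
  have key : ∀ N ∈ 𝒩', ∃ S, H.IsBiinvariantNhd S ∧ ∀ g ∈ S, ∃ a b,
      H.proj a ∈ interior (closure N) ∧ H.proj b ∈ interior (closure N) ∧ g = -a + b :=
    fun N hN => exists_isBiinvariantNhd_subset_differences hs hn isOpen_interior hN.2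
  choose! S hS hSd using key
  refine ⟨S '' 𝒩', (hc.mono fun N hN => hN.1).image S, ?_, fun R hR => ?_⟩
  · rintro _ ⟨N, hN, rfl⟩
    exact hS N hN
  obtain ⟨T, hT, hTR⟩ := hn.exists_isBiinvariantNhd_add_subset hs hR
  have hball : {p | (H.proj 0, p) ∈ H.entourage T} ∈ 𝓝 (H.proj 0) :=
    UniformSpace.mem_nhds_iff.2
      ⟨_, (quotientUniformCore_hasBasis hs hn).mem_of_mem hT, subset_rfl⟩
  obtain ⟨N, hN, hNe, hNT⟩ := h𝒩.exists_closure_subset hc hball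
  refine ⟨_, mem_image_of_mem S ⟨hN, hNe⟩, fun g hg => ?_⟩
  obtain ⟨a, b, ha, hb, rfl⟩ := hSd N ⟨hN, hNe⟩ g hg
  have ha' := (IsBiinvariantNhd.proj_mem_entourage hs hT).1 (hNT (interior_subset ha))
  have hb' := (IsBiinvariantNhd.proj_mem_entourage hs hT).1 (hNT (interior_subset hb))
  exact hT.neg_add_mem_trans hTR (hT.neg_add_mem_symm ha') hb'

lemma metrizableSpace_quotient [BaireSpace (G ⧸ H)] (hs : H.IsStrong) (hn : H.IsInnerNeutral)
    (hc : IsClosed H.carrier) (hcn : HasCountableCnCharacter (G ⧸ H)) :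
    TopologicalSpace.MetrizableSpace (G ⧸ H) := by
  obtain ⟨𝒩, h𝒩c, h𝒩⟩ := hcn (H.proj 0)
  obtain ⟨𝒞, h𝒞c, h𝒞, hcof⟩ := exists_countable_isBiinvariantNhd hs hn h𝒩c h𝒩
  let _ := quotientUniformSpace hs hn
  have := t1Space_quotient hs hc
  have hbasis : (uniformity (G ⧸ H)).HasBasis (· ∈ 𝒞) H.entourage :=
    (quotientUniformCore_hasBasis hs hn).to_hasBasis
      (fun S hS => (hcof S hS).imp fun T hT => ⟨hT.1, entourage_mono hT.2⟩)
      (fun S hS => ⟨S, h𝒞 S hS, subset_rfl⟩)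
  have : (uniformity (G ⧸ H)).IsCountablyGenerated :=
    Filter.HasCountableBasis.isCountablyGenerated ⟨hbasis, h𝒞c⟩
  exact UniformSpace.metrizableSpace

end Subgyrogroup

/-! ### Network properties of general topological spaces -/

section Networks

variable {X : Type*}

/-- `D_k(α)` depends only on the first `k` terms of `α`, so there are only countably many of
these sets. -/
lemma countable_range_segmentInter (U : (ℕ → ℕ) → Set X) :
    (range fun p : ℕ × (ℕ → ℕ) => segmentInter U p.1 p.2).Countable := by
  refine (countable_range fun q : Σ k, Fin k → ℕ =>
    ⋂ β ∈ {β : ℕ → ℕ | ∀ i, β (Fin.val i) = q.2 i}, U β).mono ?_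
  rintro _ ⟨⟨k, α⟩, rfl⟩
  refine ⟨⟨k, fun i => α i⟩, ?_⟩
  simp only [segmentInter, initialSegmentSet, Fin.forall_iff]

variable [TopologicalSpace X]

lemma HasStrongPytkeevProperty.hasCountableCnCharacter (h : HasStrongPytkeevProperty X) :
    HasCountableCnCharacter X := by
  intro x
  obtain ⟨𝒟, h𝒟c, h𝒟⟩ := h x
  refine ⟨insert {x} (insert x '' 𝒟), (h𝒟c.image _).insert _, fun O hO => ?_⟩
  set W := ⋃₀ {N | N ∈ insert {x} (insert x '' 𝒟) ∧ x ∈ N ∧ N ⊆ O}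
  have hxO := mem_of_mem_nhds hO
  by_contra hW
  -- The member `{x}` of the network is needed when no `D ∈ 𝒟` is contained in `O`.
  have hxW : x ∈ W :=
    ⟨{x}, ⟨mem_insert _ _, rfl, singleton_subset_iff.2 hxO⟩, rfl⟩
  have hcl : x ∈ closure Wᶜ \ Wᶜ := by
    refine ⟨?_, not_not_intro hxW⟩
    rwa [closure_compl, mem_compl_iff, mem_interior_iff_mem_nhds]
  obtain ⟨D, hD, hDO, hinf⟩ := h𝒟 O hO _ hcl
  obtain ⟨y, hyD, hyW⟩ := hinf.nonempty
  exact hyW ⟨insert x D, ⟨mem_insert_of_mem _ ⟨D, hD, rfl⟩, mem_insert _ _,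
    insert_subset hxO hDO⟩, mem_insert_of_mem _ hyD⟩

lemma HasCountableCkCharacter.hasCountableCnCharacter (h : HasCountableCkCharacter X) :
    HasCountableCnCharacter X := by
  intro x
  obtain ⟨𝒩, hc, h𝒩⟩ := h x
  refine ⟨𝒩, hc, fun O hO => ?_⟩
  obtain ⟨U, hU, hUK⟩ := h𝒩 O hO
  refine Filter.mem_of_superset hU fun y hy => ?_
  -- Applied to singletons, the `ck`-network condition covers `U` point by point.
  obtain ⟨ℱ, -, hℱ𝒩, hxℱ, hyℱ, hℱO⟩ := hUK {y} isCompact_singleton (singleton_subset_iff.2 hy)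
  obtain ⟨N, hN, hyN⟩ := hyℱ rfl
  exact ⟨N, ⟨hℱ𝒩 hN, hxℱ N hN, (subset_sUnion_of_mem hN).trans hℱO⟩, hyN⟩

lemma HasOmegaOmegaBaseWithConditionD.hasCountableCnCharacter
    (h : HasOmegaOmegaBaseWithConditionD X) : HasCountableCnCharacter X := by
  intro x
  obtain ⟨U, hU, -, hD⟩ := h x
  refine ⟨_, countable_range_segmentInter U, fun O hO => ?_⟩
  obtain ⟨α, -, hα⟩ := hU.mem_iff.1 hO
  refine Filter.mem_of_superset (hU.mem_of_mem (i := α) trivial) fun y hy => ?_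
  rw [hD α, mem_iUnion₂] at hy
  obtain ⟨k, -, hyk⟩ := hy
  refine ⟨_, ⟨⟨(k, α), rfl⟩, ?_, ?_⟩, hyk⟩
  · exact mem_iInter₂.2 fun β _ => mem_of_mem_nhds (hU.mem_of_mem trivial)
  · exact (biInter_subset_of_mem (show α ∈ initialSegmentSet k α from fun _ _ => rfl)).trans hα

variable [FirstCountableTopology X]

lemma hasStrongPytkeevProperty_of_firstCountable [T1Space X] : HasStrongPytkeevProperty X := by
  intro x
  obtain ⟨B, hB⟩ := (𝓝 x).exists_antitone_basis
  refine ⟨range B, countable_range B, fun U hU A hA => ?_⟩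
  obtain ⟨n, -, hn⟩ := hB.1.mem_iff.1 hU
  refine ⟨_, ⟨n, rfl⟩, hn, fun hfin => ?_⟩
  have hx : (B n ∩ A)ᶜ ∈ 𝓝 x := hfin.isClosed.isOpen_compl.mem_nhds fun h => hA.2 h.2
  obtain ⟨y, ⟨hy₁, hy₂⟩, hyA⟩ := mem_closure_iff_nhds.1 hA.1 _
    (Filter.inter_mem hx (hB.1.mem_of_mem (i := n) trivial))
  exact hy₁ ⟨hy₂, hyA⟩

lemma hasCountableCkCharacter_of_firstCountable : HasCountableCkCharacter X := by
  intro x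
  obtain ⟨B, hB⟩ := (𝓝 x).exists_antitone_basis
  refine ⟨range B, countable_range B, fun O hO => ?_⟩
  obtain ⟨n, -, hn⟩ := hB.1.mem_iff.1 hO
  have hBn : B n ∈ 𝓝 x := hB.1.mem_of_mem trivial
  refine ⟨B n, hBn, fun K _ hK => ⟨{B n}, finite_singleton _,
    singleton_subset_iff.2 ⟨n, rfl⟩, ?_, ?_, ?_⟩⟩
  · rw [sInter_singleton]
    exact mem_of_mem_nhds hBn
  · rwa [sUnion_singleton]
  · rwa [sUnion_singleton]

/-- The base `U_α = B_{α₀}`, for a decreasing base `(B_n)`, satisfies `(D)` with `k = 1`. -/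
lemma hasOmegaOmegaBaseWithConditionD_of_firstCountable :
    HasOmegaOmegaBaseWithConditionD X := by
  intro x
  obtain ⟨B, hB⟩ := (𝓝 x).exists_antitone_basis
  refine ⟨fun α => B (α 0), ⟨fun t => ?_⟩, fun α β h => hB.2 (h 0), fun α => ?_⟩
  · rw [hB.1.mem_iff]
    exact ⟨fun ⟨n, h⟩ => ⟨fun _ => n, h⟩, fun ⟨α, h⟩ => ⟨α 0, h⟩⟩
  · apply Subset.antisymm
    · intro y (hy : y ∈ B (α 0))
      refine mem_iUnion₂.2 ⟨1, le_refl 1, mem_iInter₂.2 fun β hβ => ?_⟩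
      have h0 : β 0 = α 0 := hβ 0 one_pos
      change y ∈ B (β 0)
      rwa [h0]
    · exact iUnion₂_subset fun k _ =>
        biInter_subset_of_mem (show α ∈ initialSegmentSet k α from fun _ _ => rfl)

end Networks

theorem mainTheorem3 {G : Type*} [TopologicalSpace G] [Gyrogroup G]
    [StronglyTopologicalGyrogroup G] (H : Subgyrogroup G)
    (hclosed : IsClosed H.carrier) (hneutral : H.IsNeutral) (hstrong : H.IsStrong)
    (hBaire : BaireSpace (G ⧸ H)) :
    List.TFAE [
      TopologicalSpace.MetrizableSpace (G ⧸ H),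
      HasStrongPytkeevProperty (G ⧸ H),
      HasCountableCkCharacter (G ⧸ H),
      HasCountableCnCharacter (G ⧸ H),
      HasOmegaOmegaBaseWithConditionD (G ⧸ H)] := by
  tfae_have 1 → 2 := fun _ => hasStrongPytkeevProperty_of_firstCountable
  tfae_have 1 → 3 := fun _ => hasCountableCkCharacter_of_firstCountable
  tfae_have 1 → 5 := fun _ => hasOmegaOmegaBaseWithConditionD_of_firstCountable
  tfae_have 2 → 4 := fun h => h.hasCountableCnCharacter
  tfae_have 3 → 4 := fun h => h.hasCountableCnCharacter
  tfae_have 5 → 4 := fun h => h.hasCountableCnCharacter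
  tfae_have 4 → 1 := Subgyrogroup.metrizableSpace_quotient hstrong hneutral.1 hclosed
  tfae_finish
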